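/- Let $B>1$ be an integer. For an integer $k\ge 0$ let $L_B(k)$ be the number of digits of $k$ in base $B$, that is, $L_B(k)=\lfloor\log_B(Bk)\rfloor$ for $k\ge1$ and $L_B(0)=0$. Let $$P_B(x)=(Bx+1)(Bx+2)\cdots(Bx+B-1)\sum_{m=1}^{B-1}\frac{m(B-m)}{Bx+m},$$ a polynomial in $x$, and let $(c_k)_{k\ge0}$ be the sequence of integers defined by $c_0=0$ and $c_k=c_{\lfloor k/B\rfloor}+(-1)^{k-1}6k$ for $k\ge1$. Then $$\frac{\zeta'(2)}{2\pi^2}=-\frac1{16}+\frac1{36}\sum_{k=1}^{\infty}\left(4L_B(k)-L_B\left(\left\lfloor\frac k2\right\rfloor\right)+c_k\right)\frac{P_B(k)}{Bk(Bk+1)\cdots(Bk+B)},$$ where $\zeta$ is the Riemann zeta function and the series converges absolutely. -/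

import Mathlib

/-- The `B`-ary length `L_B(k) = ⌊log_B (B k)⌋` of `k`, with `L_B(0) = 0`
(the expansion of `0` is the empty word). -/
def baseLength (B k : ℕ) : ℕ := Nat.log B (B * k)

theorem baseLength_zero (B : ℕ) : baseLength B 0 = 0 := by
  simp [baseLength]

theorem baseLength_eq_length_digits {B : ℕ} (hB : 1 < B) (k : ℕ) :
    baseLength B k = (Nat.digits B k).length := by
  rcases Nat.eq_zero_or_pos k with rfl | hk
  · simp [baseLength]
  · rw [Nat.length_digits B k hB hk.ne', baseLength, Nat.mul_comm, Nat.log_mul_base hB hk.ne']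

/-- `P_B(x) = (Bx+1)(Bx+2)⋯(Bx+B-1) ∑_{m=1}^{B-1} m(B-m)/(Bx+m)`, as a polynomial: the factor
`Bx+m` is cancelled in the `m`-th summand. -/
noncomputable def addisonPoly (B : ℕ) : Polynomial ℝ :=
  ∑ m ∈ Finset.Icc 1 (B - 1), Polynomial.C ((m : ℝ) * ((B : ℝ) - (m : ℝ))) *
    ∏ j ∈ (Finset.Icc 1 (B - 1)).erase m,
      (Polynomial.C (B : ℝ) * Polynomial.X + Polynomial.C (j : ℝ))

theorem addisonPoly_eval (B : ℕ) (x : ℝ)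
    (hx : ∀ m ∈ Finset.Icc 1 (B - 1), (B : ℝ) * x + (m : ℝ) ≠ 0) :
    (addisonPoly B).eval x =
      (∏ j ∈ Finset.Icc 1 (B - 1), ((B : ℝ) * x + (j : ℝ))) *
        ∑ m ∈ Finset.Icc 1 (B - 1),
          ((m : ℝ) * ((B : ℝ) - (m : ℝ))) / ((B : ℝ) * x + (m : ℝ)) := by
  rw [addisonPoly, Polynomial.eval_finsetSum, Finset.mul_sum]
  refine Finset.sum_congr rfl fun m hm => ?_
  rw [← Finset.mul_prod_erase _ _ hm, Polynomial.eval_mul, Polynomial.eval_prod]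
  have h := hx m hm
  simp only [Polynomial.eval_C, Polynomial.eval_add, Polynomial.eval_mul, Polynomial.eval_X]
  field_simp

/-- The weight `P_B(k) / (Bk (Bk+1) ⋯ (Bk+B))`. -/
noncomputable def addisonWeight (B k : ℕ) : ℝ :=
  (addisonPoly B).eval (k : ℝ) / ∏ j ∈ Finset.range (B + 1), ((B : ℝ) * (k : ℝ) + (j : ℝ))

/-- The sequence with `c_0 = 0` and `c_k = c_{⌊k/B⌋} + (-1)^(k-1) 6k` for `k ≥ 1`
(the value for `B ≤ 1`, where the recursion is not well founded, is irrelevant). -/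
def cSeq (B k : ℕ) : ℤ :=
  if h : k = 0 ∨ B ≤ 1 then 0
  else cSeq B (k / B) + (-1) ^ (k - 1) * (6 * (k : ℤ))
termination_by k
decreasing_by
  push Not at h
  exact Nat.div_lt_self (Nat.pos_of_ne_zero h.1) h.2

theorem cSeq_zero (B : ℕ) : cSeq B 0 = 0 := by
  rw [cSeq]; simp

theorem cSeq_rec {B k : ℕ} (hB : 1 < B) (hk : 1 ≤ k) :
    cSeq B k = cSeq B (k / B) + (-1) ^ (k - 1) * (6 * (k : ℤ)) := by
  rw [cSeq, dif_neg (by omega)]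

/-- The `k`-th term `(4 L_B(k) - L_B(⌊k/2⌋) + c_k) P_B(k) / (Bk (Bk+1) ⋯ (Bk+B))`. -/
noncomputable def addisonTerm (B k : ℕ) : ℝ :=
  (4 * (baseLength B k : ℝ) - (baseLength B (k / 2) : ℝ) + (cSeq B k : ℝ)) * addisonWeight B k

/-! Let T(k) be the trapezoidal error of `trapezoidError`. Partial fractions give the weight as T(k)
- ∑_{m<B} T(Bk+m) (`addisonWeight_eq`). Since every integer is uniquely Bk+m with 0 ≤ m < B, summing
a_k against the weight amounts to summing (a_k - a_{⌊k/B⌋}) T(k) (`hasSum_mul_addisonWeight`). For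
the coefficients in question this difference is 3 + [k=1] + 6(-1)^(k-1) k, so B disappears.

Three sums remain: ∑ T(k) = γ - 1/2, T(1) = 3/4 - log 2, and ∑ (-1)^(k-1) k T(k). The last one
splits into divergent alternating series, which Euler summation assigns the values η(1), η'(0),
η'(-1) with η(s) = (1 - 2^(1-s)) ζ(s). The logarithms of 2 cancel, leaving ζ'(-1), γ and log 2π; the
functional equation differentiated at s = 2 turns these into ζ'(2). -/

open Filter Topology

/-! ### Trapezoidal errors and the partial fractions of the weight -/

/-- The error `(1/k + 1/(k+1))/2 - log ((k+1)/k)` of the trapezoidal rule for `1/x` on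
`[k, k+1]`. -/
noncomputable def trapezoidError (k : ℕ) : ℝ :=
  (1 / (k : ℝ) + 1 / ((k : ℝ) + 1)) / 2 - (Real.log ((k : ℝ) + 1) - Real.log k)

theorem trapezoidError_nonneg {k : ℕ} (hk : 1 ≤ k) : 0 ≤ trapezoidError k := by
  have hk' : (1 : ℝ) ≤ k := by exact_mod_cast hk
  have h0 : (0 : ℝ) < k := by linarith
  have hy : (0 : ℝ) < (k + 1) / k := by positivity
  have hlog : 0 ≤ Real.log ((k + 1) / (k : ℝ)) :=
    Real.log_nonneg (by rw [le_div_iff₀ h0]; linarith)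
  -- At t = log((k+1)/k), sinh t is exactly the trapezoidal value, so the claim is t ≤ sinh t.
  have h := Real.self_le_sinh_iff.mpr hlog
  rw [Real.sinh_log hy, Real.log_div (by positivity) h0.ne'] at h
  have e : ((k + 1) / (k : ℝ) - ((k + 1) / (k : ℝ))⁻¹) / 2 = (1 / (k : ℝ) + 1 / ((k : ℝ) + 1)) / 2 := by
    field_simp
    ring
  rw [e] at h
  rw [trapezoidError]
  linarith

theorem trapezoidError_le {k : ℕ} (hk : 1 ≤ k) : trapezoidError k ≤ 1 / (k : ℝ) ^ 3 := by
  have hk' : (1 : ℝ) ≤ k := by exact_mod_cast hk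
  have h0 : (0 : ℝ) < k := by linarith
  have hs := Real.hasSum_log_one_add_inv h0
  -- The leading term of the series bounds the logarithm below by 2/(2k+1), the midpoint value.
  have h1 := hs.summable.le_tsum 0 (fun j _ => by positivity)
  rw [hs.tsum_eq] at h1
  have e : Real.log (1 + (k : ℝ)⁻¹) = Real.log ((k : ℝ) + 1) - Real.log k := by
    rw [← Real.log_div (by positivity) h0.ne']
    congr 1
    field_simp
  rw [e] at h1
  have h2 : (1 / (k : ℝ) + 1 / ((k : ℝ) + 1)) / 2 - 2 / (2 * k + 1) ≤ 1 / (k : ℝ) ^ 3 := by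
    have : (1 / (k : ℝ) + 1 / ((k : ℝ) + 1)) / 2 - 2 / (2 * k + 1) =
        1 / (2 * k * (k + 1) * (2 * k + 1)) := by
      field_simp
      ring
    rw [this]
    apply one_div_le_one_div_of_le (by positivity)
    nlinarith [pow_pos h0 2, pow_pos h0 3]
  rw [trapezoidError]
  norm_num at h1
  have h3 : 2 * (2 * (k : ℝ) + 1)⁻¹ = 2 / (2 * k + 1) := by ring
  linarith

theorem sum_range_trapezoidError (x n : ℕ) (hx : 1 ≤ x) :
    ∑ m ∈ Finset.range (n + 1), trapezoidError (x + m) =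
      1 / (2 * (x : ℝ)) + ∑ i ∈ Finset.range n, 1 / ((x : ℝ) + (i + 1)) +
        1 / (2 * ((x : ℝ) + (n + 1))) - (Real.log ((x : ℝ) + (n + 1)) - Real.log x) := by
  have h0 : (0 : ℝ) < x := by exact_mod_cast hx
  induction n with
  | zero =>
    simp [trapezoidError]
    ring
  | succ n ih =>
    rw [Finset.sum_range_succ, ih, Finset.sum_range_succ, trapezoidError]
    push_cast
    have e1 : (x : ℝ) + (n + 1) + 1 = x + (n + 1 + 1) := by ring
    rw [e1]
    field_simp
    ring

theorem Finset.prod_Icc_one_eq_prod_range {M : Type*} [CommMonoid M] (f : ℕ → M) (n : ℕ) :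
    ∏ i ∈ Finset.Icc 1 n, f i = ∏ i ∈ Finset.range n, f (i + 1) := by
  induction n with
  | zero => simp
  | succ n ih => rw [Finset.prod_Icc_succ_top (by omega), ih, Finset.prod_range_succ]

theorem Finset.sum_Icc_one_eq_sum_range {M : Type*} [AddCommMonoid M] (f : ℕ → M) (n : ℕ) :
    ∑ i ∈ Finset.Icc 1 n, f i = ∑ i ∈ Finset.range n, f (i + 1) := by
  induction n with
  | zero => simp
  | succ n ih => rw [Finset.sum_Icc_succ_top (by omega), ih, Finset.sum_range_succ]

/-- Each summand has simple poles at 0, -b and -m (m = i+1), with residues 1 - m/b, m/b and -1. -/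
theorem sum_partialFraction (x b : ℝ) (n : ℕ) (hx : 0 < x) (hb : 0 < b) :
    (∑ i ∈ Finset.range n, ((i + 1 : ℝ) * (b - (i + 1))) / (x + (i + 1))) / (x * (x + b)) =
      (n - n * (n + 1) / (2 * b)) / x + n * (n + 1) / (2 * b) / (x + b)
        - ∑ i ∈ Finset.range n, 1 / (x + (i + 1)) := by
  induction n with
  | zero => simp
  | succ n ih =>
    rw [Finset.sum_range_succ, add_div, ih, Finset.sum_range_succ]
    push_cast
    field_simp
    ring

theorem addisonWeight_eq {B k : ℕ} (hB : 1 < B) (hk : 1 ≤ k) :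
    addisonWeight B k =
      trapezoidError k - ∑ m ∈ Finset.range B, trapezoidError (B * k + m) := by
  obtain ⟨b, rfl⟩ : ∃ b, B = b + 1 := ⟨B - 1, by omega⟩
  have hk0 : (0 : ℝ) < k := by exact_mod_cast hk
  have hb0 : (0 : ℝ) < b := by exact_mod_cast (by omega : 0 < b)
  have hx1 : 1 ≤ (b + 1) * k := Nat.mul_pos (by omega) hk
  rw [sum_range_trapezoidError _ _ hx1, addisonWeight, addisonPoly_eval _ _ fun m _ => by positivity]
  simp only [Nat.add_sub_cancel]
  rw [Finset.prod_range_succ, Finset.prod_range_succ', Finset.prod_Icc_one_eq_prod_range,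
    Finset.sum_Icc_one_eq_sum_range]
  push_cast
  have hp := sum_partialFraction (((b : ℝ) + 1) * k) (b + 1) b (by positivity) (by positivity)
  set S := ∑ i ∈ Finset.range b,
    ((i + 1 : ℝ) * ((b : ℝ) + 1 - (i + 1))) / (((b : ℝ) + 1) * k + (i + 1))
  set Q := ∏ i ∈ Finset.range b, (((b : ℝ) + 1) * k + (i + 1)) with hQ
  have hQ0 : Q ≠ 0 := by
    rw [hQ]
    exact Finset.prod_ne_zero_iff.mpr fun i _ => by positivity
  have e : Q * S / (Q * (((b : ℝ) + 1) * k + 0) * (((b : ℝ) + 1) * k + (b + 1))) =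
      S / (((b : ℝ) + 1) * k * (((b : ℝ) + 1) * k + (b + 1))) := by
    rw [add_zero, mul_assoc, mul_div_mul_left _ _ hQ0]
  rw [e, hp, trapezoidError]
  have e2 : ((b : ℝ) + 1) * k + (b + 1) = (b + 1) * (k + 1) := by ring
  rw [e2, Real.log_mul (by positivity) (by positivity), Real.log_mul (by positivity) hk0.ne']
  field_simp
  ring

/-! ### Transferring the sum from the weights to the trapezoidal errors -/

theorem summable_mul_trapezoidError {a : ℕ → ℝ} {C : ℝ} (ha : ∀ k, |a k| ≤ C * k) :
    Summable fun k => a k * trapezoidError k := by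
  refine Summable.of_norm_bounded ((Real.summable_one_div_nat_pow.mpr one_lt_two).mul_left C) ?_
  intro k
  rcases Nat.eq_zero_or_pos k with rfl | hk
  · have : a 0 = 0 := by simpa using ha 0
    simp [this]
  · have h0 : (0 : ℝ) < k := by exact_mod_cast hk
    rw [Real.norm_eq_abs, abs_mul, abs_of_nonneg (trapezoidError_nonneg hk)]
    calc |a k| * trapezoidError k ≤ (C * k) * (1 / (k : ℝ) ^ 3) :=
          mul_le_mul (ha k) (trapezoidError_le hk) (trapezoidError_nonneg hk)
            ((abs_nonneg _).trans (ha k))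
      _ = C * (1 / (k : ℝ) ^ 2) := by field_simp

theorem hasSum_mul_addisonWeight {B : ℕ} (hB : 1 < B) {a : ℕ → ℝ} {C : ℝ} (hC : 0 ≤ C)
    (ha : ∀ k, |a k| ≤ C * k) :
    HasSum (fun k => a k * addisonWeight B k)
      (∑' k, (a k - a (k / B)) * trapezoidError k) := by
  have : NeZero B := ⟨by omega⟩
  have ha0 : a 0 = 0 := by simpa using ha 0
  have h1 := summable_mul_trapezoidError ha
  have h2 : Summable fun k => a (k / B) * trapezoidError k :=
    summable_mul_trapezoidError fun k => (ha _).trans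
      (mul_le_mul_of_nonneg_left (by exact_mod_cast Nat.div_le_self k B) hC)
  have h3 := (Nat.divModEquiv B).symm.hasSum_iff.mpr h2.hasSum
  have h4 := h3.prod_fiberwise (fun k => hasSum_fintype _)
  have h5 := h1.hasSum.sub h4
  have e : (∑' k, (a k - a (k / B)) * trapezoidError k) =
      ∑' k, a k * trapezoidError k - ∑' k, a (k / B) * trapezoidError k := by
    rw [← h1.tsum_sub h2]
    simp only [sub_mul]
  rw [e]
  convert! h5 using 1
  funext k
  have e1 : ∀ c : Fin B, ((fun k => a (k / B) * trapezoidError k) ∘ ⇑(Nat.divModEquiv B).symm) (k, c) =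
      a k * trapezoidError (B * k + c) := by
    intro c
    have : (k * B + (c : ℕ)) / B = k := by
      rw [mul_comm, Nat.mul_add_div (by omega), Nat.div_eq_of_lt c.2, add_zero]
    simp only [Nat.divModEquiv, Function.comp, Equiv.coe_fn_symm_mk, this]
    rw [mul_comm k B]
  rw [Finset.sum_congr rfl fun c _ => e1 c, ← Finset.mul_sum,
    Fin.sum_univ_eq_sum_range (fun m => trapezoidError (B * k + m)) B]
  -- At k = 0 the weight identity is not available, but the factor a 0 = 0 removes the term.
  rcases Nat.eq_zero_or_pos k with rfl | hk
  · simp [ha0]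
  · rw [addisonWeight_eq hB hk]
    ring

theorem hasSum_trapezoidError_succ :
    HasSum (fun k => trapezoidError (k + 1)) (Real.eulerMascheroniConstant - 1 / 2) := by
  rw [hasSum_iff_tendsto_nat_of_nonneg fun k => trapezoidError_nonneg (by omega)]
  have hp : ∀ n : ℕ, ∑ i ∈ Finset.range n, trapezoidError (i + 1) =
      (harmonic n - Real.log (n + 1)) + (1 / 2) * (1 / ((n : ℝ) + 1)) - 1 / 2 := by
    intro n
    induction n with
    | zero => simp
    | succ n ih =>
      rw [Finset.sum_range_succ, ih, trapezoidError, harmonic_succ]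
      push_cast
      field_simp
      ring
  simp only [hp]
  have := ((Real.tendsto_harmonic_sub_log_add_one).add
    ((tendsto_one_div_add_atTop_nhds_zero_nat (𝕜 := ℝ)).const_mul (1 / 2))).sub_const (1 / 2)
  simpa using this

/-! ### The digit coefficients and their B-ary differences -/

/-- The coefficient `4 L_B(k) - L_B(⌊k/2⌋) + c_k`. -/
noncomputable def addisonCoeff (B k : ℕ) : ℝ :=
  4 * (baseLength B k : ℝ) - (baseLength B (k / 2) : ℝ) + (cSeq B k : ℝ)

theorem baseLength_rec {B k : ℕ} (hB : 1 < B) (hk : 1 ≤ k) :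
    baseLength B k = baseLength B (k / B) + 1 := by
  rw [baseLength_eq_length_digits hB, baseLength_eq_length_digits hB,
    Nat.digits_def' hB hk, List.length_cons]

theorem baseLength_le {B : ℕ} (hB : 1 < B) (k : ℕ) : baseLength B k ≤ k := by
  induction k using Nat.strong_induction_on with
  | _ k ih =>
    rcases Nat.eq_zero_or_pos k with rfl | hk
    · simp [baseLength]
    · have h := Nat.div_lt_self hk hB
      rw [baseLength_rec hB hk]
      have := ih _ h
      omega

/-- The constant 12 solves C = C/2 + 6, using ⌊k/B⌋ ≤ k/2. -/
theorem abs_cSeq_le {B : ℕ} (hB : 1 < B) (k : ℕ) : |cSeq B k| ≤ 12 * (k : ℤ) := by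
  induction k using Nat.strong_induction_on with
  | _ k ih =>
    rcases Nat.eq_zero_or_pos k with rfl | hk
    · simp [cSeq_zero]
    · have h := ih _ (Nat.div_lt_self hk hB)
      rw [cSeq_rec hB hk]
      have h2 : |(-1 : ℤ) ^ (k - 1) * (6 * (k : ℤ))| = 6 * k := by
        rw [abs_mul, abs_pow, abs_neg, abs_one, one_pow, one_mul, abs_of_nonneg (by positivity)]
      have h3 : k / B ≤ k / 2 := Nat.div_le_div_left hB (by norm_num)
      have h4 := abs_add_le (cSeq B (k / B)) ((-1 : ℤ) ^ (k - 1) * (6 * (k : ℤ)))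
      omega

theorem abs_addisonCoeff_le {B : ℕ} (hB : 1 < B) (k : ℕ) : |addisonCoeff B k| ≤ 17 * k := by
  have h1 : (baseLength B k : ℝ) ≤ k := by exact_mod_cast baseLength_le hB k
  have h2 : (baseLength B (k / 2) : ℝ) ≤ k := by
    exact_mod_cast (baseLength_le hB _).trans (Nat.div_le_self k 2)
  have h3 : |(cSeq B k : ℝ)| ≤ 12 * k := by exact_mod_cast abs_cSeq_le hB k
  have h4 : (0 : ℝ) ≤ baseLength B k := by positivity
  have h5 : (0 : ℝ) ≤ baseLength B (k / 2) := by positivity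
  rw [abs_le] at h3
  rw [addisonCoeff, abs_le]
  constructor <;> linarith [h3.1, h3.2]

/-- Halving and dividing by B commute under floors, so both lengths drop by 1, giving 4 - 1 = 3. The
exception is index 1: there ⌊1/2⌋ = 0 has no digit to lose, hence the extra 1. -/
theorem addisonCoeff_succ_sub {B : ℕ} (hB : 1 < B) (k : ℕ) :
    addisonCoeff B (k + 1) - addisonCoeff B ((k + 1) / B) =
      3 + (if k = 0 then 1 else 0) + 6 * ((-1) ^ k * ((k : ℝ) + 1)) := by
  have h1 := baseLength_rec hB (k := k + 1) (by omega)
  have h2 := cSeq_rec hB (k := k + 1) (by omega)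
  have h3 : baseLength B ((k + 1) / 2) + (if k = 0 then 1 else 0) =
      baseLength B ((k + 1) / B / 2) + 1 := by
    split_ifs with h
    · subst h
      have : 1 / B = 0 := Nat.div_eq_of_lt hB
      simp [this]
    · rw [baseLength_rec hB (k := (k + 1) / 2) (by omega), Nat.div_div_eq_div_mul,
        Nat.div_div_eq_div_mul, mul_comm 2 B]
  have h3' : (baseLength B ((k + 1) / 2) : ℝ) + (if k = 0 then 1 else 0) =
      baseLength B ((k + 1) / B / 2) + 1 := by
    have := congrArg (Nat.cast : ℕ → ℝ) h3
    push_cast at this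
    exact this
  rw [addisonCoeff, addisonCoeff, h1, h2]
  push_cast
  linarith

theorem summable_alternating_mul_trapezoidError :
    Summable fun k : ℕ => (-1 : ℝ) ^ k * (((k : ℝ) + 1) * trapezoidError (k + 1)) := by
  have h := (summable_nat_add_iff 1).mpr (summable_mul_trapezoidError
    (a := fun k : ℕ => (-1 : ℝ) ^ (k + 1) * k) (C := 1) fun k => by
      rw [abs_mul, abs_pow, abs_neg, abs_one, one_pow, Nat.abs_cast])
  refine h.congr fun k => ?_
  rw [pow_succ, pow_succ]
  push_cast
  ring

theorem hasSum_addisonTerm_succ {B : ℕ} (hB : 1 < B) :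
    HasSum (fun k => addisonTerm B (k + 1))
      (3 * (Real.eulerMascheroniConstant - 1 / 2) + (3 / 4 - Real.log 2) +
        6 * ∑' k : ℕ, (-1 : ℝ) ^ k * (((k : ℝ) + 1) * trapezoidError (k + 1))) := by
  have h := hasSum_mul_addisonWeight (C := 17) hB (by norm_num) (abs_addisonCoeff_le hB)
  have ha0 : addisonCoeff B 0 = 0 := by simpa using abs_addisonCoeff_le hB 0
  have h1 := (hasSum_nat_add_iff' 1).mpr h
  rw [Finset.sum_range_one, ha0, zero_mul, sub_zero] at h1
  have h3 := hasSum_ite_eq (0 : ℕ) (trapezoidError 1)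
  have h4 := ((hasSum_trapezoidError_succ.mul_left 3).add h3).add
    (summable_alternating_mul_trapezoidError.hasSum.mul_left 6)
  have e1 : trapezoidError 1 = 3 / 4 - Real.log 2 := by
    simp [trapezoidError]
    norm_num
  have e2 : ∀ k, 3 * trapezoidError (k + 1) + (if k = 0 then trapezoidError 1 else 0) +
      6 * ((-1 : ℝ) ^ k * (((k : ℝ) + 1) * trapezoidError (k + 1))) =
      (addisonCoeff B (k + 1) - addisonCoeff B ((k + 1) / B)) * trapezoidError (k + 1) := by
    intro k
    rw [addisonCoeff_succ_sub hB]
    rcases eq_or_ne k 0 with rfl | hk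
    · simp
      ring
    · simp only [if_neg hk]
      ring
  simp only [e2] at h4
  have h5 := (hasSum_nat_add_iff
    (f := fun k => (addisonCoeff B k - addisonCoeff B (k / B)) * trapezoidError k) 1).mp h4
  rw [Finset.sum_range_one, Nat.zero_div, sub_self, zero_mul, add_zero] at h5
  rw [h5.tsum_eq, e1] at h1
  exact h1

/-! ### Euler summation by threefold averaging -/

/-- The partial sums of the alternating series `∑ (-1)^k f k`. -/
def altPartialSum (f : ℕ → ℂ) (n : ℕ) : ℂ := ∑ k ∈ Finset.range n, (-1) ^ k * f k

/-- `EulerSum f a` says that the alternating series `∑ (-1)^k f k` has the value `a` after its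
partial sums have been averaged three times. -/
def EulerSum (f : ℕ → ℂ) (a : ℂ) : Prop :=
  Tendsto (fun n => (altPartialSum f n + 3 * altPartialSum f (n + 1) +
    3 * altPartialSum f (n + 2) + altPartialSum f (n + 3)) / 8) atTop (𝓝 a)

theorem altPartialSum_succ (f : ℕ → ℂ) (n : ℕ) :
    altPartialSum f (n + 1) = altPartialSum f n + (-1) ^ n * f n :=
  Finset.sum_range_succ _ _

namespace EulerSum

variable {f g : ℕ → ℂ} {a b : ℂ}

theorem unique (hf : EulerSum f a) (hg : EulerSum f b) : a = b := tendsto_nhds_unique hf hg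

theorem add (hf : EulerSum f a) (hg : EulerSum g b) : EulerSum (fun k => f k + g k) (a + b) := by
  refine (Tendsto.add hf hg).congr fun n => ?_
  simp only [altPartialSum, mul_add, Finset.sum_add_distrib]
  ring

theorem const_mul (c : ℂ) (hf : EulerSum f a) : EulerSum (fun k => c * f k) (c * a) := by
  refine (Tendsto.const_mul c hf).congr fun n => ?_
  have : ∀ m, altPartialSum (fun k => c * f k) m = c * altPartialSum f m := fun m => by
    simp only [altPartialSum, Finset.mul_sum]
    exact Finset.sum_congr rfl fun _ _ => by ring
  simp only [this]
  ring

theorem of_tendsto (h : Tendsto (altPartialSum f) atTop (𝓝 a)) : EulerSum f a := by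
  have h1 := h.comp (tendsto_add_atTop_nat 1)
  have h2 := h.comp (tendsto_add_atTop_nat 2)
  have h3 := h.comp (tendsto_add_atTop_nat 3)
  have := (((h.add (h1.const_mul 3)).add (h2.const_mul 3)).add h3).div_const 8
  have e : (a + 3 * a + 3 * a + a) / 8 = a := by ring
  rw [e] at this
  exact this

theorem of_hasSum (h : HasSum (fun k => (-1) ^ k * f k) a) : EulerSum f a :=
  of_tendsto h.tendsto_sum_nat

theorem shift (hf : EulerSum f a) : EulerSum (fun k => f (k + 1)) (f 0 - a) := by
  have h := (hf.comp (tendsto_add_atTop_nat 1)).const_sub (f 0)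
  have : ∀ m, altPartialSum (fun k => f (k + 1)) m = f 0 - altPartialSum f (m + 1) := fun m => by
    rw [altPartialSum, altPartialSum, Finset.sum_range_succ', Finset.sum_congr rfl fun k _ =>
      (by rw [pow_succ]; ring : (-1) ^ (k + 1) * f (k + 1) = -((-1) ^ k * f (k + 1))),
      Finset.sum_neg_distrib]
    ring
  refine h.congr fun n => ?_
  simp only [this, Function.comp]
  ring

theorem one : EulerSum (fun _ => 1) (1 / 2) := by
  have h : ∀ n, altPartialSum (fun _ => 1) n = (1 - (-1) ^ n) / 2 := fun n => by
    induction n with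
    | zero => simp [altPartialSum]
    | succ n ih => rw [altPartialSum_succ, ih, pow_succ]; ring
  refine tendsto_const_nhds.congr fun n => ?_
  simp only [h, pow_succ]
  ring

end EulerSum

/-- The initial terms of the Euler transform. -/
noncomputable def eulerHead (f : ℕ → ℂ) : ℂ := (7 * f 0 - 4 * f 1 + f 2) / 8

/-- The terms of the Euler transform. -/
noncomputable def eulerTail (f : ℕ → ℂ) (k : ℕ) : ℂ :=
  (-1) ^ k * (f k - 3 * f (k + 1) + 3 * f (k + 2) - f (k + 3)) / 8

/-- The averaged partial sum equals `eulerHead` at n = 0, and its successive increments are the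
signed third differences divided by 8. -/
theorem EulerSum.of_hasSum_eulerTail {f : ℕ → ℂ} {a : ℂ} (h : HasSum (eulerTail f) a) :
    EulerSum f (eulerHead f + a) := by
  refine (h.tendsto_sum_nat.const_add (eulerHead f)).congr fun n => ?_
  induction n with
  | zero =>
    simp [altPartialSum, Finset.sum_range_succ, eulerHead]
    ring
  | succ n ih =>
    rw [Finset.sum_range_succ, ← add_assoc, ih, eulerTail]
    simp only [altPartialSum_succ, pow_succ]
    ring

theorem norm_sub_le_of_hasDerivAt {f f' : ℝ → ℂ} {x C : ℝ}
    (hf : ∀ y, x ≤ y → HasDerivAt f (f' y) y) (hC : ∀ y, x ≤ y → ‖f' y‖ ≤ C) :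
    ∀ y, x ≤ y → ‖f (y + 1) - f y‖ ≤ C := by
  intro y hy
  have := Convex.norm_image_sub_le_of_norm_hasDerivWithin_le (s := Set.Ici x)
    (fun z hz => (hf z hz).hasDerivWithinAt) (fun z hz => hC z hz) (convex_Ici x)
    (show y ∈ Set.Ici x from hy) (show y + 1 ∈ Set.Ici x from by simp; linarith)
  simpa using this

theorem hasDerivAt_sub_shift {f f' : ℝ → ℂ} {x : ℝ}
    (hf : ∀ y, x ≤ y → HasDerivAt f (f' y) y) :
    ∀ y, x ≤ y → HasDerivAt (fun z => f (z + 1) - f z) (f' (y + 1) - f' y) y :=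
  fun y hy => ((hf (y + 1) (by linarith)).comp_add_const y 1).sub (hf y hy)

/-- The mean value inequality is applied three times, each time trading a difference for a
derivative. -/
theorem norm_thirdDifference_le {f f₁ f₂ f₃ : ℝ → ℂ} {x C : ℝ}
    (h₁ : ∀ y, x ≤ y → HasDerivAt f (f₁ y) y) (h₂ : ∀ y, x ≤ y → HasDerivAt f₁ (f₂ y) y)
    (h₃ : ∀ y, x ≤ y → HasDerivAt f₂ (f₃ y) y) (hC : ∀ y, x ≤ y → ‖f₃ y‖ ≤ C) :
    ‖f x - 3 * f (x + 1) + 3 * f (x + 2) - f (x + 3)‖ ≤ C := by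
  have k₁ := norm_sub_le_of_hasDerivAt h₃ hC
  have k₂ := norm_sub_le_of_hasDerivAt (hasDerivAt_sub_shift h₂) k₁
  have k₃ := norm_sub_le_of_hasDerivAt (hasDerivAt_sub_shift (hasDerivAt_sub_shift h₁)) k₂ x le_rfl
  have e2 : x + 1 + 1 = x + 2 := by ring
  have e3 : x + 2 + 1 = x + 3 := by ring
  rw [norm_sub_rev, e2, e3] at k₃
  refine le_of_eq_of_le (congrArg norm ?_) k₃
  ring

/-! ### The eta function on a region containing -1, 0, 1 and 2 -/

/-- A bounded convex open region to the right of `Re s = -3/2`. -/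
def etaRegion : Set ℂ := {s | -(3 / 2) < s.re} ∩ Metric.ball 0 10

theorem isOpen_etaRegion : IsOpen etaRegion :=
  (isOpen_lt continuous_const Complex.continuous_re).inter Metric.isOpen_ball

theorem convex_etaRegion : Convex ℝ etaRegion :=
  (convex_halfSpace_re_gt _).inter (convex_ball _ _)

/-- The terms of the Dirichlet series `∑ (n+1)^(-s)`. -/
noncomputable def dirichletTerm (s : ℂ) (k : ℕ) : ℂ := ((k : ℂ) + 1) ^ (-s)

/-- The third derivative of x^(-s) is -s(s+1)(s+2) x^(-s-3). In the ball the factors are at most 10,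
11, 12, and Re s > -3/2 makes the power at most x^(-3/2), which is summable uniformly in s. -/
theorem norm_eulerTail_dirichletTerm_le {s : ℂ} (hs : s ∈ etaRegion) (k : ℕ) :
    ‖eulerTail (dirichletTerm s) k‖ ≤ 10 * 11 * 12 / 8 * (1 / ((k : ℝ) + 1) ^ (3 / 2 : ℝ)) := by
  obtain ⟨hre, hball⟩ := hs
  have hre' : -(3 / 2) < s.re := hre
  have hn : ‖s‖ < 10 := by simpa using hball
  set x : ℝ := k + 1 with hx
  have hx1 : 1 ≤ x := by simp [hx]
  have hder : ∀ (r : ℂ) (c : ℂ) (y : ℝ), x ≤ y →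
      HasDerivAt (fun z : ℝ => c * (z : ℂ) ^ r) (c * r * (y : ℂ) ^ (r - 1)) y := by
    intro r c y hy
    -- The exponent does vanish at s = 0 and s = -1, both needed later.
    rcases eq_or_ne r 0 with rfl | hr
    · simpa using hasDerivAt_const y c
    · rw [mul_assoc]
      exact (hasDerivAt_ofReal_cpow_const (by linarith) hr).const_mul c
  have hC : ∀ y : ℝ, x ≤ y → ‖1 * (-s) * (-s - 1) * (-s - 1 - 1) * (y : ℂ) ^ (-s - 1 - 1 - 1)‖ ≤
      10 * 11 * 12 * (1 / x ^ (3 / 2 : ℝ)) := by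
    intro y hy
    have hy0 : 0 < y := by linarith
    have n1 : ‖-s - 1‖ ≤ 11 := by
      calc ‖-s - 1‖ ≤ ‖-s‖ + ‖(1 : ℂ)‖ := norm_sub_le _ _
        _ ≤ 11 := by rw [norm_neg, norm_one]; linarith
    have n2 : ‖-s - 1 - 1‖ ≤ 12 := by
      calc ‖-s - 1 - 1‖ ≤ ‖-s - 1‖ + ‖(1 : ℂ)‖ := norm_sub_le _ _
        _ ≤ 12 := by rw [norm_one]; linarith
    have n3 : ‖(y : ℂ) ^ (-s - 1 - 1 - 1)‖ ≤ 1 / x ^ (3 / 2 : ℝ) := by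
      rw [Complex.norm_cpow_eq_rpow_re_of_pos hy0, one_div, ← Real.rpow_neg (by linarith)]
      calc y ^ (-s - 1 - 1 - 1).re ≤ y ^ (-(3 / 2) : ℝ) := by
            apply Real.rpow_le_rpow_of_exponent_le (by linarith)
            simp
            linarith
        _ ≤ x ^ (-(3 / 2) : ℝ) :=
            Real.rpow_le_rpow_of_nonpos (by linarith) hy (by norm_num)
    rw [norm_mul, norm_mul, norm_mul, one_mul, norm_neg]
    gcongr
  have h := norm_thirdDifference_le (hder (-s) 1) (hder (-s - 1) _) (hder (-s - 1 - 1) _) hC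
  rw [eulerTail, norm_div, norm_mul, norm_pow, norm_neg, norm_one, one_pow, one_mul]
  have e : dirichletTerm s k - 3 * dirichletTerm s (k + 1) + 3 * dirichletTerm s (k + 2) -
      dirichletTerm s (k + 3) = 1 * (x : ℂ) ^ (-s) - 3 * (1 * ((x + 1 : ℝ) : ℂ) ^ (-s)) +
        3 * (1 * ((x + 2 : ℝ) : ℂ) ^ (-s)) - 1 * ((x + 3 : ℝ) : ℂ) ^ (-s) := by
    simp only [dirichletTerm, hx, one_mul]
    push_cast
    ring_nf
  rw [e, show ‖(8 : ℂ)‖ = 8 by norm_num]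
  linarith

theorem summable_etaBound :
    Summable fun k : ℕ => 10 * 11 * 12 / 8 * (1 / ((k : ℝ) + 1) ^ (3 / 2 : ℝ)) := by
  refine Summable.mul_left _ ?_
  have := (summable_nat_add_iff 1).mpr
    (Real.summable_one_div_nat_rpow (p := 3 / 2) |>.mpr (by norm_num))
  simpa using! this

/-- The analytic continuation of `∑ (-1)^n (n+1)^(-s)` given by the Euler transform. -/
noncomputable def eulerEta (s : ℂ) : ℂ :=
  eulerHead (dirichletTerm s) + ∑' k, eulerTail (dirichletTerm s) k

theorem hasDerivAt_dirichletTerm (k : ℕ) (s : ℂ) :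
    HasDerivAt (fun s => dirichletTerm s k) (-(dirichletTerm s k * Complex.log ((k : ℂ) + 1))) s := by
  have := (hasDerivAt_neg s).const_cpow (c := (k : ℂ) + 1) (Or.inl (Nat.cast_add_one_ne_zero k))
  simpa [dirichletTerm] using! this

theorem eulerSum_eulerEta {s : ℂ} (hs : s ∈ etaRegion) : EulerSum (dirichletTerm s) (eulerEta s) :=
  .of_hasSum_eulerTail (Summable.of_norm_bounded summable_etaBound
    (norm_eulerTail_dirichletTerm_le hs)).hasSum

theorem hasDerivAt_eulerHead {f : ℂ → ℕ → ℂ} {f' : ℕ → ℂ} {s : ℂ}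
    (h : ∀ k, HasDerivAt (fun s => f s k) (f' k) s) :
    HasDerivAt (fun s => eulerHead (f s)) (eulerHead f') s :=
  ((((h 0).const_mul 7).sub ((h 1).const_mul 4)).add (h 2)).div_const 8

theorem hasDerivAt_eulerTail {f : ℂ → ℕ → ℂ} {f' : ℕ → ℂ} {s : ℂ}
    (h : ∀ k, HasDerivAt (fun s => f s k) (f' k) s) (k : ℕ) :
    HasDerivAt (fun s => eulerTail (f s) k) (eulerTail f' k) s :=
  (((((h k).sub ((h (k + 1)).const_mul 3)).add ((h (k + 2)).const_mul 3)).sub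
    (h (k + 3))).const_mul _).div_const 8

theorem differentiableOn_tsum_eulerTail :
    DifferentiableOn ℂ (fun s => ∑' k, eulerTail (dirichletTerm s) k) etaRegion :=
  Complex.differentiableOn_tsum_of_summable_norm summable_etaBound
    (fun k s _ => (hasDerivAt_eulerTail (fun j => hasDerivAt_dirichletTerm j s)
      k).differentiableAt.differentiableWithinAt)
    isOpen_etaRegion fun k _ hs => norm_eulerTail_dirichletTerm_le hs k

theorem differentiableOn_eulerEta : DifferentiableOn ℂ eulerEta etaRegion :=
  DifferentiableOn.add (fun s _ => (hasDerivAt_eulerHead fun j =>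
    hasDerivAt_dirichletTerm j s).differentiableAt.differentiableWithinAt)
    differentiableOn_tsum_eulerTail

theorem eulerSum_deriv_eulerEta {s : ℂ} (hs : s ∈ etaRegion) :
    EulerSum (fun k => -(dirichletTerm s k * Complex.log ((k : ℂ) + 1))) (deriv eulerEta s) := by
  have h := Complex.hasSum_deriv_of_summable_norm summable_etaBound
    (fun k s _ => (hasDerivAt_eulerTail (fun j => hasDerivAt_dirichletTerm j s)
      k).differentiableAt.differentiableWithinAt)
    isOpen_etaRegion (fun k _ hs => norm_eulerTail_dirichletTerm_le hs k) hs
  simp only [fun k => (hasDerivAt_eulerTail (fun j => hasDerivAt_dirichletTerm j s) k).deriv] at h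
  have e : deriv eulerEta s = eulerHead (fun k => -(dirichletTerm s k * Complex.log ((k : ℂ) + 1)))
      + deriv (fun s => ∑' k, eulerTail (dirichletTerm s) k) s :=
    ((hasDerivAt_eulerHead fun j => hasDerivAt_dirichletTerm j s).add
      (differentiableOn_tsum_eulerTail.differentiableAt
        (isOpen_etaRegion.mem_nhds hs)).hasDerivAt).deriv
  rw [e]
  exact .of_hasSum_eulerTail h

theorem hasSum_alternating_dirichletTerm {s : ℂ} (hs : 1 < s.re) :
    HasSum (fun k => (-1) ^ k * dirichletTerm s k) ((1 - 2 ^ (1 - s)) * riemannZeta s) := by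
  have hsum : Summable (dirichletTerm s) := by
    have := (summable_nat_add_iff 1).mpr (Complex.summable_one_div_nat_cpow.mpr hs)
    refine this.congr fun k => ?_
    rw [dirichletTerm, Complex.cpow_neg, one_div]
    push_cast
    rfl
  have hz : HasSum (dirichletTerm s) (riemannZeta s) := by
    rw [zeta_eq_tsum_one_div_nat_add_one_cpow hs]
    convert! hsum.hasSum using 2
    funext k
    rw [dirichletTerm, Complex.cpow_neg, one_div]
  -- Terms are indexed from n+1, so odd indices carry the even integers 2k+2.
  have hodd : HasSum (fun k => dirichletTerm s (2 * k + 1)) (2 ^ (-s) * riemannZeta s) := by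
    convert! hz.mul_left (2 ^ (-s)) using 1
    funext k
    have := Complex.mul_cpow_ofReal_nonneg (a := 2) (b := (k : ℝ) + 1) (by norm_num)
      (by positivity) (-s)
    rw [dirichletTerm, dirichletTerm]
    push_cast at this ⊢
    rw [← this]
    congr 1
    ring
  have heven : Summable fun k => dirichletTerm s (2 * k) :=
    hsum.comp_injective (mul_right_injective₀ two_ne_zero)
  have h1 := heven.hasSum.even_add_odd hodd
  have h2 := h1.unique hz
  have h3 : HasSum (fun k => (-1) ^ k * dirichletTerm s k)
      (∑' k, dirichletTerm s (2 * k) + -(2 ^ (-s) * riemannZeta s)) := by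
    refine HasSum.even_add_odd ?_ ?_
    · simpa [pow_mul] using heven.hasSum
    · simpa [pow_mul, pow_succ] using hodd.neg
  convert! h3 using 1
  have e : (2 : ℂ) ^ (1 - s) = 2 * 2 ^ (-s) := by
    rw [sub_eq_add_neg, Complex.cpow_add _ _ two_ne_zero, Complex.cpow_one]
  rw [e]
  linear_combination -h2

/-- Both sides are analytic on the connected region and agree near 2, where the series converges
absolutely; the factor s - 1 absorbs the pole of ζ. -/
theorem sub_one_mul_eulerEta {s : ℂ} (hs : s ∈ etaRegion) :
    (s - 1) * eulerEta s = (1 - 2 ^ (1 - s)) * riemannZeta₁ s := by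
  have hg : Differentiable ℂ fun s : ℂ => (1 - 2 ^ (1 - s)) * riemannZeta₁ s := by
    refine Differentiable.mul ?_ differentiable_riemannZeta₁
    refine (differentiable_const _).sub ?_
    exact Differentiable.const_cpow (by fun_prop) (Or.inl two_ne_zero)
  have hf : DifferentiableOn ℂ (fun s : ℂ => (s - 1) * eulerEta s) etaRegion :=
    DifferentiableOn.mul (by fun_prop) differentiableOn_eulerEta
  have h2 : (2 : ℂ) ∈ etaRegion := ⟨by norm_num, by simp; norm_num⟩
  refine (hf.analyticOnNhd isOpen_etaRegion).eqOn_of_preconnected_of_eventuallyEq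
    (hg.differentiableOn.analyticOnNhd isOpen_etaRegion) convex_etaRegion.isPreconnected h2 ?_ hs
  have h3 : {s : ℂ | 1 < s.re} ∈ 𝓝 (2 : ℂ) :=
    (isOpen_lt continuous_const Complex.continuous_re).mem_nhds (by simp)
  filter_upwards [h3, isOpen_etaRegion.mem_nhds h2] with z hz hz'
  have hz1 : z ≠ 1 := fun h => by simp [h] at hz
  have := (eulerSum_eulerEta hz').unique (.of_hasSum (hasSum_alternating_dirichletTerm hz))
  rw [this, riemannZeta_eq_inv_sub_mul hz1]
  field_simp [sub_ne_zero.mpr hz1]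

theorem eulerEta_eq {s : ℂ} (hs : s ∈ etaRegion) (h1 : s ≠ 1) :
    eulerEta s = (1 - 2 ^ (1 - s)) * riemannZeta s := by
  have h := sub_one_mul_eulerEta hs
  rw [riemannZeta_eq_inv_sub_mul h1]
  have := sub_ne_zero.mpr h1
  field_simp
  linear_combination h

theorem hasDerivAt_one_sub_two_cpow (s : ℂ) :
    HasDerivAt (fun s : ℂ => 1 - (2 : ℂ) ^ (1 - s)) (2 ^ (1 - s) * Complex.log 2) s := by
  have := (((hasDerivAt_id s).const_sub 1).const_cpow (c := 2) (Or.inl two_ne_zero)).const_sub 1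
  simpa using! this

/-- Both sides of `sub_one_mul_eulerEta` vanish at s = 1, so their derivatives there are compared.
-/
theorem eulerEta_one : eulerEta 1 = Complex.log 2 := by
  have h1 : (1 : ℂ) ∈ etaRegion := ⟨by norm_num, by simp⟩
  have hL : HasDerivAt (fun s => (s - 1) * eulerEta s) (eulerEta 1) 1 := by
    have := ((hasDerivAt_id (1 : ℂ)).sub_const 1).mul (differentiableOn_eulerEta.differentiableAt
      (isOpen_etaRegion.mem_nhds h1)).hasDerivAt
    simpa using! this
  have hR : HasDerivAt (fun s => (1 - (2 : ℂ) ^ (1 - s)) * riemannZeta₁ s) (Complex.log 2) 1 := by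
    have := (hasDerivAt_one_sub_two_cpow 1).mul (differentiable_riemannZeta₁ 1).hasDerivAt
    simpa using! this
  refine hL.unique (hR.congr_of_eventuallyEq ?_)
  filter_upwards [isOpen_etaRegion.mem_nhds h1] with s hs using sub_one_mul_eulerEta hs

theorem deriv_eulerEta {s : ℂ} (hs : s ∈ etaRegion) (h1 : s ≠ 1) :
    deriv eulerEta s =
      2 ^ (1 - s) * Complex.log 2 * riemannZeta s + (1 - 2 ^ (1 - s)) * deriv riemannZeta s := by
  have h := (hasDerivAt_one_sub_two_cpow s).mul (differentiableAt_riemannZeta h1).hasDerivAt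
  refine (h.congr_of_eventuallyEq ?_).deriv
  filter_upwards [isOpen_etaRegion.mem_nhds hs, isOpen_ne.mem_nhds h1] with z hz hz1
  exact eulerEta_eq hz hz1

/-! ### The functional equation and the final evaluation -/

theorem riemannZeta_neg_one : riemannZeta (-1) = -1 / 12 := by
  have := riemannZeta_neg_nat_eq_bernoulli 1
  norm_num [bernoulli_two] at this ⊢
  exact this

theorem deriv_riemannZeta_two :
    deriv riemannZeta 2 / (2 * (Real.pi : ℂ) ^ 2) = deriv riemannZeta (-1) - 1 / 12 +
      ((Real.eulerMascheroniConstant : ℂ) + Complex.log (2 * Real.pi)) / 12 := by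
  have hpi : (Real.pi : ℂ) ≠ 0 := by exact_mod_cast Real.pi_ne_zero
  have hL : HasDerivAt (fun s => riemannZeta (1 - s)) (-deriv riemannZeta (-1)) 2 := by
    have h1 : HasDerivAt riemannZeta (deriv riemannZeta (-1)) (1 - 2) := by
      rw [show (1 - 2 : ℂ) = -1 by norm_num]
      exact (differentiableAt_riemannZeta (s := -1) (by norm_num)).hasDerivAt
    have := h1.comp (2 : ℂ) ((hasDerivAt_id (2 : ℂ)).const_sub 1)
    simpa using! this
  have hpow : HasDerivAt (fun s : ℂ => (2 * (Real.pi : ℂ)) ^ (-s))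
      (-((2 * (Real.pi : ℂ)) ^ (-2 : ℂ) * Complex.log (2 * Real.pi))) 2 := by
    have := (hasDerivAt_neg (2 : ℂ)).const_cpow (c := 2 * (Real.pi : ℂ))
      (Or.inl (mul_ne_zero two_ne_zero hpi))
    simpa using! this
  have hG : HasDerivAt Complex.Gamma (1 - Real.eulerMascheroniConstant) 2 := by
    have := Complex.hasDerivAt_Gamma_nat 1
    norm_num at this
    convert! this using 1
    ring
  -- Since sin π = 0, the cosine factor contributes only its value -1.
  have hcos : HasDerivAt (fun s : ℂ => Complex.cos (Real.pi * s / 2)) 0 2 := by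
    have := (((hasDerivAt_id (2 : ℂ)).const_mul (Real.pi : ℂ)).div_const 2).ccos
    simpa using! this
  have hR := (((hpow.const_mul 2).mul hG).mul hcos).mul
    (differentiableAt_riemannZeta (s := 2) (by norm_num)).hasDerivAt
  have hE : (fun s => riemannZeta (1 - s)) =ᶠ[𝓝 2] fun s => 2 * (2 * (Real.pi : ℂ)) ^ (-s) *
      Complex.Gamma s * Complex.cos (Real.pi * s / 2) * riemannZeta s := by
    have h3 : {s : ℂ | 1 < s.re} ∈ 𝓝 (2 : ℂ) :=
      (isOpen_lt continuous_const Complex.continuous_re).mem_nhds (by simp)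
    filter_upwards [h3] with s hs
    have hs' : 1 < s.re := hs
    refine riemannZeta_one_sub (fun n h => ?_) fun h => ?_
    · rw [h] at hs'
      simp at hs'
      have : (0 : ℝ) ≤ n := n.cast_nonneg
      linarith
    · simp [h] at hs'
  have hU := hL.unique (hR.congr_of_eventuallyEq hE)
  have hp2 : (2 * (Real.pi : ℂ)) ^ (-2 : ℂ) = 1 / (4 * (Real.pi : ℂ) ^ 2) := by
    rw [Complex.cpow_neg, show (2 : ℂ) = ((2 : ℕ) : ℂ) by norm_num, Complex.cpow_natCast]
    push_cast
    ring
  have hG2 : Complex.Gamma 2 = 1 := by simp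
  have hc2 : Complex.cos (Real.pi * 2 / 2) = -1 := by simp
  simp only [Pi.mul_apply, hp2, hG2, hc2, riemannZeta_two] at hU
  field_simp at hU ⊢
  linear_combination hU

theorem tsum_alternating_mul_trapezoidError :
    ((∑' k : ℕ, (-1 : ℝ) ^ k * (((k : ℝ) + 1) * trapezoidError (k + 1)) : ℝ) : ℂ) =
      Complex.log 2 / 2 + deriv eulerEta 0 - 2 * deriv eulerEta (-1) := by
  have h0 : (0 : ℂ) ∈ etaRegion := ⟨by norm_num, by simp⟩
  have h1 : (1 : ℂ) ∈ etaRegion := ⟨by norm_num, by simp⟩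
  have hm : (-1 : ℂ) ∈ etaRegion := ⟨by norm_num, by simp⟩
  have s1 := eulerSum_eulerEta h1
  have s0 := (eulerSum_deriv_eulerEta h0).const_mul (-1)
  have sm := (eulerSum_deriv_eulerEta hm).const_mul (-1)
  have hT := Complex.hasSum_ofReal.mpr summable_alternating_mul_trapezoidError.hasSum
  have hT' : EulerSum (fun k : ℕ => ((((k : ℝ) + 1) * trapezoidError (k + 1) : ℝ) : ℂ))
      ((∑' k : ℕ, (-1 : ℝ) ^ k * (((k : ℝ) + 1) * trapezoidError (k + 1)) : ℝ) : ℂ) := by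
    refine EulerSum.of_hasSum ?_
    simpa using! hT
  have hS := (((EulerSum.one.add (s1.shift.const_mul (-1 / 2))).add s0.shift).add
    (sm.shift.const_mul (-1))).add sm
  -- With n = k+1, n T(n) = 1 - 1/(2(n+1)) + log(n+1) - (n+1) log(n+1) + n log n. The shift flips
  -- the sign of an alternating sum, so the last two pieces reinforce each other into -2η'(-1).
  have e : ∀ k : ℕ, ((((k : ℝ) + 1) * trapezoidError (k + 1) : ℝ) : ℂ) =
      1 + -1 / 2 * dirichletTerm 1 (k + 1) +
        -1 * -(dirichletTerm 0 (k + 1) * Complex.log (((k + 1 : ℕ) : ℂ) + 1)) +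
        -1 * (-1 * -(dirichletTerm (-1) (k + 1) * Complex.log (((k + 1 : ℕ) : ℂ) + 1))) +
        -1 * -(dirichletTerm (-1) k * Complex.log ((k : ℂ) + 1)) := by
    intro k
    have l1 : Complex.log ((k : ℂ) + 1) = (Real.log ((k : ℝ) + 1) : ℂ) := by
      rw [Complex.ofReal_log (by positivity)]
      push_cast
      rfl
    have l2 : Complex.log (((k + 1 : ℕ) : ℂ) + 1) = (Real.log ((k : ℝ) + 1 + 1) : ℂ) := by
      rw [Complex.ofReal_log (by positivity)]
      push_cast
      rfl
    rw [l1, l2]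
    simp only [dirichletTerm, neg_zero, neg_neg, Complex.cpow_zero, Complex.cpow_one,
      Complex.cpow_neg_one, trapezoidError]
    push_cast
    have n1 : (k : ℂ) + 1 ≠ 0 := Nat.cast_add_one_ne_zero k
    have n2 : (k : ℂ) + 1 + 1 ≠ 0 := by
      simpa only [Nat.cast_add, Nat.cast_one] using Nat.cast_add_one_ne_zero (R := ℂ) (k + 1)
    field_simp
    ring
  have hu := hT'.unique (by simpa only [e] using hS)
  rw [hu, eulerEta_one]
  simp [dirichletTerm]
  ring

theorem mainTheorem12 (B : ℕ) (hB : 1 < B) :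
    Summable (fun k : ℕ => addisonTerm B (k + 1)) ∧
      deriv riemannZeta 2 / (2 * (Real.pi : ℂ) ^ 2) =
        -(1 / 16 : ℂ) + (1 / 36 : ℂ) * ((∑' k : ℕ, addisonTerm B (k + 1) : ℝ) : ℂ) := by
  have h := hasSum_addisonTerm_succ hB
  refine ⟨h.summable, ?_⟩
  have h0 : (0 : ℂ) ∈ etaRegion := ⟨by norm_num, by simp⟩
  have hm : (-1 : ℂ) ∈ etaRegion := ⟨by norm_num, by simp⟩
  have c2 : (2 : ℂ) ^ (1 - -1 : ℂ) = 4 := by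
    rw [show (1 - -1 : ℂ) = ((2 : ℕ) : ℂ) by norm_num, Complex.cpow_natCast]
    norm_num
  have l2 : (Real.log 2 : ℂ) = Complex.log 2 := by
    rw [Complex.ofReal_log (by norm_num)]
    norm_num
  rw [h.tsum_eq, deriv_riemannZeta_two]
  push_cast [-Complex.ofReal_tsum]
  rw [tsum_alternating_mul_trapezoidError, deriv_eulerEta h0 (by norm_num),
    deriv_eulerEta hm (by norm_num), deriv_riemannZeta_zero, riemannZeta_zero,
    riemannZeta_neg_one, c2, l2, sub_zero, Complex.cpow_one]
  ring
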